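/- Let $X$ be a complex Banach space, $\mathcal{B}(X)$ the Banach algebra of bounded linear operators on $X$, and $T\in\mathcal{B}(X)$, with resolvent set $\rho(T)$. For a linear operator $S$ on a complex vector space, let $d(S)\in\mathbb{N}\cup\{\infty\}$ be the least integer $q\ge 0$ such that the ranges of $S^q$ and $S^{q+1}$ coincide, with $d(S)=\infty$ if there is no such $q$. Let $$\sigma_{desc}(T)=\{\lambda\in\mathbb{C} : d(\lambda-T)=\infty\},\qquad \rho_{desc}(T)=\mathbb{C}\setminus\sigma_{desc}(T),$$ $$\sigma_{desc}(T,\mathcal{B}(X))=\{\lambda\in\mathbb{C} : d(L_{T-\lambda})=\infty\},$$ where $L_A:\mathcal{B}(X)\to\mathcal{B}(X)$, $L_A(S)=AS$, is left multiplication by $A\in\mathcal{B}(X)$. **Theorem 2.** If $G\cap\rho(T)\neq\emptyset$ for every connected component $G$ of $\rho_{desc}(T)$, then $$\sigma_{desc}(T)=\sigma_{desc}(T,\mathcal{B}(X)).$$ -/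

import Mathlib

namespace DescentSpectrum

/-- The descent of a linear endomorphism `f`: the least `q : ℕ` such that
`R(f ^ q) = R(f ^ (q + 1))`, and `⊤` if there is no such `q`. -/
noncomputable def descent {M : Type*} [AddCommGroup M] [Module ℂ M] (f : M →ₗ[ℂ] M) : ℕ∞ :=
  ⨅ (q : ℕ) (_ : LinearMap.range (f ^ q) = LinearMap.range (f ^ (q + 1))), (q : ℕ∞)

/-- The descent spectrum of a bounded operator `T` on `X`:
the set of `z` such that `z - T` has infinite descent as an operator on `X`. -/
def opDescentSpectrum {X : Type*} [NormedAddCommGroup X] [NormedSpace ℂ X]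
    (T : X →L[ℂ] X) : Set ℂ :=
  {z | descent ((algebraMap ℂ (X →L[ℂ] X) z - T : X →L[ℂ] X) : X →ₗ[ℂ] X) = ⊤}

/-- The descent resolvent set of a bounded operator, the complement of its descent spectrum. -/
def opDescentResolvent {X : Type*} [NormedAddCommGroup X] [NormedSpace ℂ X]
    (T : X →L[ℂ] X) : Set ℂ :=
  (opDescentSpectrum T)ᶜ

/-- The descent of an element `a` of a complex algebra with unit:
the descent of the left multiplication operator `L_a : x ↦ a * x`. -/
noncomputable def algDescent {A : Type*} [Ring A] [Algebra ℂ A] (a : A) : ℕ∞ :=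
  descent (LinearMap.mulLeft ℂ a)

/-- The descent spectrum of an element `a` of a complex algebra with unit. -/
def algDescentSpectrum {A : Type*} [Ring A] [Algebra ℂ A] (a : A) : Set ℂ :=
  {z | algDescent (a - algebraMap ℂ A z) = ⊤}

end DescentSpectrum

open Filter Topology

namespace DescentSpectrum

/-! Only one inclusion needs work: a range equality for `A = z - T` must become a factorization `A ^
q = A ^ (q + 1) * S` with `S` bounded. Let `N = ker (A ^ q)`. Finite descent makes the operator `B`
induced on `X ⧸ N` surjective. If `z` is a limit of resolvent points, `B` is a surjective limit of
invertible operators `B + ν`, hence invertible, and `S` is built from its inverse. As `A` is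
nilpotent on `N`, `A + ν` is then invertible for all small `ν ≠ 0`. So within the descent resolvent
set the closure of the resolvent set is relatively open as well as closed, and it fills every
component that it meets. -/

theorem descent_ne_top_iff {M : Type*} [AddCommGroup M] [Module ℂ M] (f : M →ₗ[ℂ] M) :
    descent f ≠ ⊤ ↔ ∃ q : ℕ, LinearMap.range (f ^ q) = LinearMap.range (f ^ (q + 1)) := by
  simp [descent, iInf_eq_top]

/-- Left multiplication by `a` has finite descent iff `a ^ q` is a right multiple of
`a ^ (q + 1)` for some `q`. -/
theorem algDescent_ne_top_iff {A : Type*} [Ring A] [Algebra ℂ A] (a : A) :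
    algDescent a ≠ ⊤ ↔ ∃ (q : ℕ) (s : A), a ^ q = a ^ (q + 1) * s := by
  rw [algDescent, descent_ne_top_iff]
  refine exists_congr fun q => ⟨fun h => ?_, ?_⟩
  · have h1 : a ^ q ∈ LinearMap.range (LinearMap.mulLeft ℂ a ^ q) := by
      rw [LinearMap.pow_mulLeft]
      exact ⟨1, by simp⟩
    rw [h, LinearMap.pow_mulLeft] at h1
    obtain ⟨s, hs⟩ := h1
    exact ⟨s, by simpa using hs.symm⟩
  · rintro ⟨s, hs⟩
    simp only [LinearMap.pow_mulLeft]
    apply le_antisymm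
    · rintro _ ⟨x, rfl⟩
      exact ⟨s * x, by simp [hs]⟩
    · rintro _ ⟨x, rfl⟩
      exact ⟨a * x, by simp [pow_succ]⟩

theorem notMem_opDescentSpectrum_iff {X : Type*} [NormedAddCommGroup X] [NormedSpace ℂ X]
    (T : X →L[ℂ] X) (z : ℂ) :
    z ∉ opDescentSpectrum T ↔ ∃ q : ℕ, ∀ x, ∃ y,
      ((algebraMap ℂ (X →L[ℂ] X) z - T) ^ q) x = ((algebraMap ℂ (X →L[ℂ] X) z - T) ^ (q + 1)) y := by
  set A := algebraMap ℂ (X →L[ℂ] X) z - T with hA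
  have hpow (n : ℕ) (x : X) : ((A : X →ₗ[ℂ] X) ^ n) x = (A ^ n) x := by
    induction n generalizing x with
    | zero => rfl
    | succ n ih =>
      rw [pow_succ, pow_succ, Module.End.mul_apply, mul_apply_eq_comp, ← ih]
      rfl
  change descent (A : X →ₗ[ℂ] X) ≠ ⊤ ↔ _
  rw [descent_ne_top_iff]
  refine exists_congr fun q => ⟨fun h x => ?_, fun h => le_antisymm ?_ ?_⟩
  · obtain ⟨y, hy⟩ := h.le ⟨x, rfl⟩
    exact ⟨y, by simpa only [hpow] using hy.symm⟩
  · rintro _ ⟨x, rfl⟩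
    obtain ⟨y, hy⟩ := h x
    exact ⟨y, by simpa only [hpow] using hy.symm⟩
  · rintro _ ⟨x, rfl⟩
    exact ⟨A x, by rw [hpow, hpow, pow_succ, mul_apply_eq_comp]⟩

theorem notMem_algDescentSpectrum_iff {A : Type*} [Ring A] [Algebra ℂ A] (a : A) (z : ℂ) :
    z ∉ algDescentSpectrum a ↔
      ∃ (q : ℕ) (s : A), (algebraMap ℂ A z - a) ^ q = (algebraMap ℂ A z - a) ^ (q + 1) * s := by
  change algDescent (a - algebraMap ℂ A z) ≠ ⊤ ↔ _
  rw [algDescent_ne_top_iff, ← neg_sub a]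
  refine exists_congr fun q => ?_
  generalize a - algebraMap ℂ A z = b
  -- Exactly one of `q`, `q + 1` is odd; its sign is absorbed by `s ↦ -s`.
  rcases Nat.even_or_odd q with hq | hq
  · rw [hq.neg_pow, hq.add_one.neg_pow]
    exact (Equiv.neg A).exists_congr fun s => by simp
  · rw [hq.neg_pow, hq.add_one.neg_pow]
    exact (Equiv.neg A).exists_congr fun s => by simp

/-- A surjective operator which is a limit of invertible operators `B + ν` with `ν → 0`
is invertible. -/
theorem isUnit_of_surjective_of_frequently {Y : Type*} [NormedAddCommGroup Y] [NormedSpace ℂ Y]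
    [CompleteSpace Y] (B : Y →L[ℂ] Y) (hB : Function.Surjective B)
    (h : ∃ᶠ ν in 𝓝 (0 : ℂ), IsUnit (B + algebraMap ℂ (Y →L[ℂ] Y) ν)) : IsUnit B := by
  obtain ⟨C, hC, hpre⟩ := B.exists_preimage_norm_le hB
  have hsmall : ∀ᶠ ν in 𝓝 (0 : ℂ), ‖ν‖ * C < 1 / 3 := by
    have : Tendsto (fun ν : ℂ => ‖ν‖ * C) (𝓝 0) (𝓝 (‖(0 : ℂ)‖ * C)) :=
      (continuous_norm.mul continuous_const).tendsto 0
    refine this.eventually_lt_const ?_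
    norm_num
  obtain ⟨ν, ⟨u, hu⟩, hν⟩ := (h.and_eventually hsmall).exists
  set R : Y →L[ℂ] Y := ↑u⁻¹ with hR
  -- Bounded preimages under `B` control the inverse `R` of `B + ν`: if `B z = y`, then `R y = z - ν
  -- R z`. Since `‖ν‖ * C < 1 / 3`, this gives `‖R‖ ≤ 3 C / 2` and `‖ν R‖ < 1 / 2`.
  have hbound : ‖R‖ ≤ C + ‖R‖ * (‖ν‖ * C) := by
    refine R.opNorm_le_bound (by positivity) fun y => ?_
    obtain ⟨z, hz, hzn⟩ := hpre y
    have huz : (u : Y →L[ℂ] Y) z = y + ν • z := by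
      rw [hu, add_apply, hz, Algebra.algebraMap_eq_smul_one]
      simp
    have hRy : R y = z - R (ν • z) := by
      have : R ((u : Y →L[ℂ] Y) z) = z := by
        rw [← mul_apply_eq_comp, hR, Units.inv_mul, one_apply_eq_self]
      rw [huz, map_add] at this
      exact eq_sub_of_add_eq this
    calc ‖R y‖ ≤ ‖z‖ + ‖R (ν • z)‖ := hRy ▸ norm_sub_le _ _
      _ ≤ ‖z‖ + ‖R‖ * (‖ν‖ * ‖z‖) := by
        gcongr
        exact (R.le_opNorm _).trans_eq (by rw [norm_smul])
      _ ≤ C * ‖y‖ + ‖R‖ * (‖ν‖ * (C * ‖y‖)) := by gcongr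
      _ = (C + ‖R‖ * (‖ν‖ * C)) * ‖y‖ := by ring
  have hlt : ‖ν • R‖ < 1 := by
    rw [norm_smul]
    have h1 : ‖R‖ ≤ C * (3 / 2) := by nlinarith [norm_nonneg R]
    nlinarith [norm_nonneg ν]
  have hfac : B = u * (1 - ν • R) := by
    rw [mul_sub, mul_one, mul_smul_comm, hR, Units.mul_inv, hu, Algebra.algebraMap_eq_smul_one,
      add_sub_cancel_right]
  rw [hfac]
  exact u.isUnit.mul (isUnit_one_sub_of_norm_lt_one hlt)

theorem eventually_isUnit_add_algebraMap {Y : Type*} [NormedAddCommGroup Y] [NormedSpace ℂ Y]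
    [CompleteSpace Y] {B : Y →L[ℂ] Y} (hB : IsUnit B) :
    ∀ᶠ ν in 𝓝 (0 : ℂ), IsUnit (B + algebraMap ℂ (Y →L[ℂ] Y) ν) := by
  have hcont : Continuous fun ν : ℂ => B + algebraMap ℂ (Y →L[ℂ] Y) ν :=
    continuous_const.add (continuous_algebraMap ℂ _)
  exact ((Units.isOpen (R := Y →L[ℂ] Y)).preimage hcont).mem_nhds (by simpa using hB)

/-- If `A` has finite descent `q` and `A + ν` is invertible for arbitrarily small `ν`, then
`A ^ q ∈ A ^ (q + 1) * B(X)` and `A + ν` is invertible for all small `ν ≠ 0`. -/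
theorem exists_pow_eq_and_eventually_isUnit {X : Type*} [NormedAddCommGroup X] [NormedSpace ℂ X]
    [CompleteSpace X] (A : X →L[ℂ] X) (q : ℕ) (hq : ∀ x, ∃ y, (A ^ q) x = (A ^ (q + 1)) y)
    (h : ∃ᶠ ν in 𝓝 (0 : ℂ), IsUnit (A + algebraMap ℂ (X →L[ℂ] X) ν)) :
    (∃ S, A ^ q = A ^ (q + 1) * S) ∧
      ∀ᶠ ν in 𝓝[≠] (0 : ℂ), IsUnit (A + algebraMap ℂ (X →L[ℂ] X) ν) := by
  let N : Submodule ℂ X := (A ^ q).ker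
  have hN : IsClosed (N : Set X) := (A ^ q).isClosed_ker
  have memN (x : X) : x ∈ N ↔ (A ^ q) x = 0 := LinearMap.mem_ker
  have hcomm (x : X) : (A ^ q) (A x) = A ((A ^ q) x) := by
    rw [← mul_apply_eq_comp, ← mul_apply_eq_comp, ← pow_succ, ← pow_succ']
  let π : X →L[ℂ] X ⧸ N := N.mkQL
  have hπ : Function.Surjective π := N.mkQ_surjective
  have hπ0 (x : X) : π x = 0 ↔ (A ^ q) x = 0 := (N.mkQ_apply x ▸ Submodule.Quotient.mk_eq_zero N)
  let φ : X ⧸ N →L[ℂ] X := N.liftQL (A ^ q) le_rfl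
  have hφ (x : X) : φ (π x) = (A ^ q) x := rfl
  have hle : N ≤ (π.comp A).ker := by
    intro x hx
    rw [LinearMap.mem_ker]
    change π (A x) = 0
    rw [hπ0, hcomm, (memN x).1 hx, map_zero]
  let B : X ⧸ N →L[ℂ] X ⧸ N := N.liftQL (π.comp A) hle
  have hB (x : X) : B (π x) = π (A x) := rfl
  have hBν (ν : ℂ) (x : X) : (B + algebraMap ℂ (X ⧸ N →L[ℂ] X ⧸ N) ν) (π x) =
      π ((A + algebraMap ℂ (X →L[ℂ] X) ν) x) := by
    simp [Algebra.algebraMap_eq_smul_one, hB]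
  have hAν (ν : ℂ) (x : X) : (A + algebraMap ℂ (X →L[ℂ] X) ν) x = A x + ν • x := by
    simp [Algebra.algebraMap_eq_smul_one]
  have hBsurj : Function.Surjective B := by
    intro y
    obtain ⟨x, rfl⟩ := hπ y
    obtain ⟨x', hx'⟩ := hq x
    refine ⟨π x', ?_⟩
    rw [hB, ← sub_eq_zero, ← map_sub, hπ0, map_sub, hx', pow_succ, mul_apply_eq_comp,
      sub_self]
  have hBunit : IsUnit B := by
    refine isUnit_of_surjective_of_frequently B hBsurj (h.mono fun ν hν => ?_)
    rw [ContinuousLinearMap.isUnit_iff_bijective] at hν ⊢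
    refine ⟨(injective_iff_map_eq_zero _).2 fun y hy => ?_, fun y => ?_⟩
    -- `A ^ q` commutes with the injective `A + ν`, so `(A + ν) x ∈ N` forces `x ∈ N`.
    · obtain ⟨x, rfl⟩ := hπ y
      rw [hBν, hπ0, hAν, map_add, hcomm, map_smul, ← hAν] at hy
      exact (hπ0 x).2 ((injective_iff_map_eq_zero _).1 hν.1 _ hy)
    · obtain ⟨x, rfl⟩ := hπ y
      obtain ⟨x', rfl⟩ := hν.2 x
      exact ⟨π x', hBν ν x'⟩
  constructor
  · obtain ⟨u, hu⟩ := hBunit.pow (q + 1)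
    have hpow (n : ℕ) (y : X ⧸ N) : (A ^ n) (φ y) = φ ((B ^ n) y) := by
      induction n generalizing y with
      | zero => rfl
      | succ n ih =>
        rw [pow_succ, pow_succ, mul_apply_eq_comp, mul_apply_eq_comp, ← ih]
        obtain ⟨x, rfl⟩ := hπ y
        rw [hB, hφ, hφ, hcomm]
    -- With `A φ = φ B` and `φ π = A ^ q`, the choice `S = φ B⁻⁽q⁺¹⁾ π` works.
    refine ⟨φ.comp ((↑u⁻¹ : X ⧸ N →L[ℂ] X ⧸ N).comp π), ?_⟩
    have hinv (y : X ⧸ N) : (u : X ⧸ N →L[ℂ] X ⧸ N) ((↑u⁻¹ : X ⧸ N →L[ℂ] X ⧸ N) y) = y := by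
      rw [← mul_apply_eq_comp, Units.mul_inv, one_apply_eq_self]
    ext x
    rw [mul_apply_eq_comp, ContinuousLinearMap.comp_apply,
      ContinuousLinearMap.comp_apply, hpow, ← hu, hinv, hφ]
  · have hev := eventually_isUnit_add_algebraMap hBunit
    filter_upwards [hev.filter_mono nhdsWithin_le_nhds, self_mem_nhdsWithin] with ν hν hν0
    have hν0 : ν ≠ 0 := hν0
    rw [ContinuousLinearMap.isUnit_iff_bijective] at hν ⊢
    set c : X →L[ℂ] X := algebraMap ℂ (X →L[ℂ] X) ν with hc
    -- On `N` the term `A ^ q` vanishes, so up to a nonzero scalar the cofactor `W` is a right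
    -- inverse of `A + ν` there.
    have hdvd : A + c ∣ A ^ q - (-c) ^ q := by
      have : Commute A (-c) := (Algebra.commute_algebraMap_right ν A).neg_right
      simpa using this.sub_dvd_pow_sub_pow q
    obtain ⟨W, hW⟩ := hdvd
    have hcq (x : X) : ((-c) ^ q) x = (-ν) ^ q • x := by
      rw [hc, ← map_neg, ← map_pow, Algebra.algebraMap_eq_smul_one]
      simp
    have hνq : (-ν) ^ q ≠ 0 := pow_ne_zero _ (neg_ne_zero.2 hν0)
    constructor
    · refine (injective_iff_map_eq_zero _).2 fun x hx => ?_
      have hπx : π x = 0 := by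
        apply (injective_iff_map_eq_zero _).1 hν.1
        rw [hBν, hx, map_zero]
      have hAx : A x = (-ν) • x := by
        rw [hAν] at hx
        rw [neg_smul, eq_neg_of_add_eq_zero_left hx]
      have hpow (n : ℕ) : (A ^ n) x = (-ν) ^ n • x := by
        induction n with
        | zero => simp
        | succ n ih =>
          rw [pow_succ, mul_apply_eq_comp, hAx, map_smul, ih, smul_smul, pow_succ']
      rw [hπ0, hpow] at hπx
      exact (smul_eq_zero.1 hπx).resolve_left hνq
    · intro y
      -- Solve modulo `N`, then remove the error `n ∈ N` using `W`.
      obtain ⟨v, hv⟩ := hν.2 (π y)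
      obtain ⟨x, rfl⟩ := hπ v
      rw [hBν, eq_comm, ← sub_eq_zero, ← map_sub, hπ0] at hv
      set n := y - (A + c) x with hn
      have h1 : (A + c) (W n) = -((-ν) ^ q • n) := by
        rw [← mul_apply_eq_comp, ← hW, sub_apply, hv, hcq, zero_sub]
      refine ⟨x - ((-ν) ^ q)⁻¹ • W n, ?_⟩
      rw [map_sub, map_smul, h1, smul_neg, inv_smul_smul₀ hνq, hn]
      abel

/-- The translate of `exists_pow_eq_and_eventually_isUnit` to a point of the closure of the
resolvent set. -/
theorem exists_pow_eq_and_mem_interior {X : Type*} [NormedAddCommGroup X] [NormedSpace ℂ X]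
    [CompleteSpace X] (T : X →L[ℂ] X) {z : ℂ} (hz : z ∈ opDescentResolvent T)
    (hcl : z ∈ closure (resolventSet ℂ T)) :
    z ∉ algDescentSpectrum T ∧ z ∈ interior (closure (resolventSet ℂ T)) := by
  obtain ⟨q, hq⟩ := (notMem_opDescentSpectrum_iff T z).1 hz
  have hiff (ν : ℂ) : IsUnit (algebraMap ℂ (X →L[ℂ] X) z - T + algebraMap ℂ (X →L[ℂ] X) ν) ↔
      z + ν ∈ resolventSet ℂ T := by
    rw [spectrum.mem_resolventSet_iff, map_add, sub_add_eq_add_sub]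
  have hfreq : ∃ᶠ ν in 𝓝 (0 : ℂ),
      IsUnit (algebraMap ℂ (X →L[ℂ] X) z - T + algebraMap ℂ (X →L[ℂ] X) ν) := by
    simp_rw [hiff]
    rwa [mem_closure_iff_frequently, ← map_add_left_nhds_zero, frequently_map] at hcl
  obtain ⟨⟨S, hS⟩, hev⟩ := exists_pow_eq_and_eventually_isUnit _ q hq hfreq
  refine ⟨(notMem_algDescentSpectrum_iff T z).2 ⟨q, S, hS⟩, ?_⟩
  rw [mem_interior_iff_mem_nhds, ← map_add_left_nhds_zero, mem_map]
  filter_upwards [eventually_nhdsWithin_iff.1 hev] with ν hν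
  by_cases h0 : ν = 0
  · simpa [h0] using hcl
  · exact subset_closure ((hiff ν).1 (hν h0))

theorem opDescentSpectrum_subset_algDescentSpectrum {X : Type*} [NormedAddCommGroup X]
    [NormedSpace ℂ X] (T : X →L[ℂ] X) : opDescentSpectrum T ⊆ algDescentSpectrum T := by
  intro z
  contrapose
  rw [notMem_algDescentSpectrum_iff, notMem_opDescentSpectrum_iff]
  rintro ⟨q, S, hS⟩
  exact ⟨q, fun x => ⟨S x, by rw [← mul_apply_eq_comp, ← hS]⟩⟩

end DescentSpectrum

open DescentSpectrum in
theorem theorem2 {X : Type*} [NormedAddCommGroup X] [NormedSpace ℂ X] [CompleteSpace X]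
    (T : X →L[ℂ] X)
    (hT : ∀ z ∈ DescentSpectrum.opDescentResolvent T,
      (connectedComponentIn (DescentSpectrum.opDescentResolvent T) z ∩
        resolventSet ℂ T).Nonempty) :
    DescentSpectrum.opDescentSpectrum T = DescentSpectrum.algDescentSpectrum T := by
  refine (opDescentSpectrum_subset_algDescentSpectrum T).antisymm fun z => ?_
  contrapose
  intro hz
  have hsub : connectedComponentIn (opDescentResolvent T) z ⊆
      interior (closure (resolventSet ℂ T)) := by
    -- The open set `interior (closure (resolventSet ℂ T))` meets the component and is relatively
    -- closed in it.
    refine isPreconnected_connectedComponentIn.subset_of_closure_inter_subset isOpen_interior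
      ((hT z hz).mono (Set.inter_subset_inter_right _ ?_)) ?_
    · exact (spectrum.isOpen_resolventSet T).subset_interior_iff.2 subset_closure
    · rintro w ⟨hw, hwG⟩
      exact (exists_pow_eq_and_mem_interior T (connectedComponentIn_subset _ _ hwG)
        (closure_minimal interior_subset isClosed_closure hw)).2
  exact (exists_pow_eq_and_mem_interior T hz
    (interior_subset (hsub (mem_connectedComponentIn hz)))).1
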